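/- **Setting.** Fix a depth $L\ge 1$ and widths $w_0,\dots,w_L$ with $d=w_0$, $\mathcal C=w_L$, and put $W=\max_{0\le \ell\le L}w_\ell$. Fix activation functions $\sigma_1,\dots,\sigma_L:\mathbb R\to\mathbb R$, applied entrywise, where $\sigma_\ell$ is $\rho_\ell$-Lipschitz and $\sigma_\ell(0)=0$. For weight matrices $A=(A_1,\dots,A_L)$ with $A_\ell\in\mathbb R^{w_\ell\times w_{\ell-1}}$, let $$F_A(x)=A_L\,\sigma_{L-1}\bigl(A_{L-1}\,\sigma_{L-2}(\cdots\sigma_1(A_1x)\cdots)\bigr)$$ be the fully connected network (no activation follows the last matrix; $\sigma_L$ enters only through the constant $\rho_L$ below). Let $\mathrm l:\mathbb R^{\mathcal C}\times\mathcal Y\to[0,B]$ be a loss that is measurable in its second argument and $\Lambda$-Lipschitz in its first argument with respect to the $L^\infty$ norm. Let $\mathcal D$ be a probability distribution on $\mathbb R^d\times\mathcal Y$, and let $S=((x_i,y_i))_{i=1}^N$, $N\ge1$, be drawn i.i.d. from $\mathcal D$. Write $\mathfrak B=\max_{i\le N}\|x_i\|$ (Euclidean norm) and let $\|A_\ell\|$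 be the spectral norm. **Theorem.** For every $\delta>0$, with probability at least $1-\delta$ over the draw of $S$, every choice of weight matrices $A$ satisfies $$\begin{aligned}\mathbb E_{(x,y)\sim\mathcal D}\bigl[\mathrm l(F_A(x),y)\bigr]-\frac1N\sum_{i=1}^N \mathrm l(F_A(x_i),y_i)\le{}& 6(B+1)\sqrt{\frac{\log(4/\delta)}{N}}\\&+\frac{240\sqrt{\log_2(4\Gamma_R)}\,\log(N)\,(B+1)}{\sqrt N}\Bigl[\sum_{\ell=1}^L (w_\ell+w_{\ell-1})\operatorname{rank}(A_\ell)\Bigr]^{1/2}\\&+\sqrt{\frac{\log(4/\delta)+2\log\bigl[(\mathfrak B+2)\prod_{\ell=1}^L(\|A_\ell\|+2)\bigr]+L\log W}{N}},\end{aligned}$$ where $$\Gamma_R=(\mathfrak B+2)(L\Lambda+1)\,W N\prod_{i=1}^L\bigl[(\rho_i+1)(\|A_i\|+2)+1\bigr].$$ Since the sum in the second term is a non-negative integer, the bound holds a fortiori with that sum in place of its square root. -/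

import Mathlib

open MeasureTheory
open scoped NNReal Matrix

noncomputable section

/-- A tuple of weight matrices `A₁, …, A_L`, where the `ℓ`-th one has size `w_ℓ × w_{ℓ-1}`.
Layers are indexed by `ℓ : Fin L` (so `ℓ = 0` is the first layer), widths by `Fin (L + 1)`. -/
abbrev Weights {L : ℕ} (w : Fin (L + 1) → ℕ) : Type :=
  ∀ ℓ : Fin L, Matrix (Fin (w ℓ.succ)) (Fin (w ℓ.castSucc)) ℝ

/-- The map applied entrywise after the `ℓ`-th weight matrix: `σ_ℓ` for the hidden layers, and
nothing after the last matrix. -/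
def layerActivation {L : ℕ} (σ : Fin L → ℝ → ℝ) (ℓ : Fin L) : ℝ → ℝ :=
  if (ℓ : ℕ) + 1 = L then id else σ ℓ

/-- The fully connected network `F_A(x) = A_L σ_{L-1}(A_{L-1} σ_{L-2}(⋯ σ_1(A_1 x) ⋯))`. -/
def network {L : ℕ} {w : Fin (L + 1) → ℕ} (σ : Fin L → ℝ → ℝ) (A : Weights w)
    (x : EuclideanSpace ℝ (Fin (w 0))) : Fin (w (Fin.last L)) → ℝ :=
  Fin.induction (motive := fun k => Fin (w k) → ℝ) (fun j => x j)
    (fun ℓ h j => layerActivation σ ℓ ((A ℓ *ᵥ h) j)) (Fin.last L)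

/-- The spectral norm of a real matrix: its operator norm between Euclidean spaces. -/
def matrixSpectralNorm {m n : ℕ} (A : Matrix (Fin m) (Fin n) ℝ) : ℝ :=
  ‖LinearMap.toContinuousLinearMap (Matrix.toEuclideanLin A)‖

/-- The maximal width `W = max_{0 ≤ ℓ ≤ L} w_ℓ`. -/
def maxWidth {L : ℕ} (w : Fin (L + 1) → ℕ) : ℕ := Finset.univ.sup w

/-- `𝔅 = max_i ‖x_i‖`, the largest Euclidean norm of an input in the sample `S`. -/
def sampleRadius {d N : ℕ} {Y : Type*} (S : Fin N → EuclideanSpace ℝ (Fin d) × Y) : ℝ :=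
  ⨆ i, ‖(S i).1‖

/-- The generalization gap `E[l(F(x), y)] - (1/N) ∑ i, l(F(x_i), y_i)` of a predictor `F`. -/
def generalizationGap {d c N : ℕ} {Y : Type*} [MeasurableSpace Y]
    (D : Measure (EuclideanSpace ℝ (Fin d) × Y)) (l : (Fin c → ℝ) → Y → ℝ)
    (S : Fin N → EuclideanSpace ℝ (Fin d) × Y)
    (F : EuclideanSpace ℝ (Fin d) → Fin c → ℝ) : ℝ :=
  (∫ z, l (F z.1) z.2 ∂D) - (1 / (N : ℝ)) * ∑ i, l (F (S i).1) (S i).2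

/-- `Γ_R = (𝔅 + 2) (L Λ + 1) W N ∏_i ((ρ_i + 1) (‖A_i‖ + 2) + 1)`, with `b` in the place
of `𝔅`. -/
def gammaR {L : ℕ} {w : Fin (L + 1) → ℕ} (N : ℕ) (lip : ℝ≥0) (ρ : Fin L → ℝ≥0) (b : ℝ)
    (A : Weights w) : ℝ :=
  (b + 2) * (L * lip + 1) * maxWidth w * N *
    ∏ ℓ, (((ρ ℓ : ℝ) + 1) * (matrixSpectralNorm (A ℓ) + 2) + 1)

/-- `∑_ℓ (w_ℓ + w_{ℓ-1}) rank(A_ℓ)`. -/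
def rankComplexity {L : ℕ} {w : Fin (L + 1) → ℕ} (A : Weights w) : ℝ :=
  ∑ ℓ, ((w ℓ.succ : ℝ) + w ℓ.castSucc) * (A ℓ).rank

end

/-!
The bound follows from a finite-precision description of the networks; neither symmetrization nor
chaining is involved.

Put `u = log (4 / δ)`. Since the deviation never exceeds `B`, only the case `u < N` matters. The
inputs may be unbounded, so fix a quantile `R` of the input norm: inputs of norm larger than `R`
have probability at most `u / N`, whereas the largest norm in the sample is at least `R` except
with probability `exp (-u)` (`exists_radius`). Truncating the loss to inputs of norm at most `R`
then costs only `B u / N` in expectation, and nothing in the empirical mean, which enters with a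
negative sign (`deviation_le_of_close`).

A matrix of rank `r` is a product `U V` with inner dimension `r`, the columns of `U` being an
orthonormal basis of its range (`exists_rank_factorization`), so that weights `A` are described by
`∑ (w_ℓ + w_{ℓ-1}) rank A_ℓ` real numbers. Rounding them to a grid of mesh `2^(-4m)`, where `2^m` is
about `Γ_R`, changes each matrix by at most `2^(-m)` in spectral norm (`exists_gridCode_close`), hence
the loss by at most `1 / N` on the ball containing the sample (`norm_network_sub_le`,
`exists_gridIndex_close`). The rounded networks of all levels `m` and all rank profiles form a
countable family, which carries prior weights of total mass at most one
(`tsum_exp_neg_gridCost_le`); the negative logarithm of the weight needed for `A` is at most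
`9 log₂ (4 Γ_R) ∑ (w_ℓ + w_{ℓ-1}) rank A_ℓ`. Because the family is countable and the weights are
fixed in advance, `m` may depend on the sample and on `A`, and the weighted union bound for
Hoeffding's inequality (`measure_exists_deviation_le`) yields the claim for all `A` without
vanishing layers. If some `A_ℓ` vanishes, the network is zero and one application of Hoeffding's
inequality suffices.
-/

/-! ### Concentration for a weighted countable family -/

/-- Hoeffding's inequality for the one-sided deviation of an empirical mean from its expectation,
at the deviation for which the failure probability is `exp (-a)`. -/
lemma measure_deviation_le {Z : Type*} [MeasurableSpace Z] (D : Measure Z)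
    [IsProbabilityMeasure D] {N : ℕ} (hN : 1 ≤ N) {f : Z → ℝ} (hf : Measurable f) {C : ℝ}
    (hC : 0 < C) (hb : ∀ z, 0 ≤ f z ∧ f z ≤ C) {a : ℝ} (ha : 0 ≤ a) :
    Measure.pi (fun _ : Fin N => D)
        {S | C * √(a / (2 * N)) < ∫ z, f z ∂D - (1 / (N : ℝ)) * ∑ i, f (S i)} ≤
      ENNReal.ofReal (Real.exp (-a)) := by
  have hN' : (0 : ℝ) < N := by exact_mod_cast hN
  have hint : ∀ i : Fin N, ∫ S : Fin N → Z, -f (S i) ∂(Measure.pi fun _ => D)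
      = -∫ z, f z ∂D := by
    intro i
    rw [integral_neg, integral_comp_eval (μ := fun _ : Fin N => D) hf.aestronglyMeasurable]
  have hsub : ∀ i ∈ (Finset.univ : Finset (Fin N)), ProbabilityTheory.HasSubgaussianMGF
      (fun S : Fin N → Z => -f (S i) + ∫ z, f z ∂D) ((‖C‖₊ / 2) ^ 2)
      (Measure.pi fun _ => D) := by
    intro i _
    have h := ProbabilityTheory.hasSubgaussianMGF_of_mem_Icc (a := -C) (b := 0)
      (μ := Measure.pi fun _ : Fin N => D) (X := fun S => -f (S i))
      (hf.comp (measurable_pi_apply i)).neg.aemeasurable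
      (.of_forall fun S => ⟨by linarith [(hb (S i)).2], by linarith [(hb (S i)).1]⟩)
    rw [hint] at h
    simpa using h
  have hind : ProbabilityTheory.iIndepFun (fun (i : Fin N) (S : Fin N → Z) =>
      -f (S i) + ∫ z, f z ∂D) (Measure.pi fun _ => D) :=
    ProbabilityTheory.iIndepFun_pi (μ := fun _ : Fin N => D)
      (X := fun _ z => -f z + ∫ z, f z ∂D) (fun i => by fun_prop)
  have key := ProbabilityTheory.HasSubgaussianMGF.measure_sum_ge_le_of_iIndepFun hind hsub
    (ε := N * (C * √(a / (2 * N)))) (by positivity)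
  have hexp : -(N * (C * √(a / (2 * N)))) ^ 2 /
      (2 * ((∑ _i ∈ (Finset.univ : Finset (Fin N)), (‖C‖₊ / 2) ^ 2 : ℝ≥0) : ℝ)) = -a := by
    have : ((‖C‖₊ : ℝ≥0) : ℝ) = C := by simp [abs_of_pos hC]
    rw [mul_pow, mul_pow, Real.sq_sqrt (by positivity)]
    simp only [Finset.sum_const, Finset.card_univ, Fintype.card_fin, nsmul_eq_mul, NNReal.coe_mul,
      NNReal.coe_natCast, NNReal.coe_pow, NNReal.coe_div, this, NNReal.coe_ofNat]
    field_simp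
  push_cast at key hexp
  rw [hexp] at key
  rw [← ENNReal.ofReal_toReal (measure_ne_top (Measure.pi fun _ : Fin N => D) _)]
  refine ENNReal.ofReal_le_ofReal (le_trans ?_ key)
  refine measureReal_mono fun S hS => ?_
  simp only [Set.mem_ofPred_eq] at hS ⊢
  rw [Finset.sum_add_distrib, Finset.sum_neg_distrib]
  simp only [Finset.sum_const, Finset.card_univ, Fintype.card_fin, nsmul_eq_mul]
  have h2 := mul_le_mul_of_nonneg_left hS.le hN'.le
  have h3 : (N : ℝ) * (∫ z, f z ∂D - (1 / (N : ℝ)) * ∑ i, f (S i))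
      = -∑ i, f (S i) + N * ∫ z, f z ∂D := by
    field_simp; ring
  linarith

/-- The union bound over a countable family in which the member `i` is given the prior weight
`exp (-a i)`. -/
lemma measure_exists_deviation_le {Z ι : Type*} [MeasurableSpace Z] [Countable ι]
    (D : Measure Z) [IsProbabilityMeasure D] {N : ℕ} (hN : 1 ≤ N) {f : ι → Z → ℝ}
    (hf : ∀ i, Measurable (f i)) {C : ℝ} (hC : 0 < C) (hb : ∀ i z, 0 ≤ f i z ∧ f i z ≤ C)
    {a : ι → ℝ} (ha : ∀ i, 0 ≤ a i) (hsum : ∑' i, ENNReal.ofReal (Real.exp (-a i)) ≤ 1)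
    {u : ℝ} (hu : 0 ≤ u) :
    Measure.pi (fun _ : Fin N => D)
        {S | ∃ i, C * √((a i + u) / (2 * N)) <
          ∫ z, f i z ∂D - (1 / (N : ℝ)) * ∑ j, f i (S j)} ≤
      ENNReal.ofReal (Real.exp (-u)) := by
  rw [Set.ofPred_exists]
  calc _ ≤ ∑' i, Measure.pi (fun _ : Fin N => D)
        {S | C * √((a i + u) / (2 * N)) < ∫ z, f i z ∂D - (1 / (N : ℝ)) * ∑ j, f i (S j)} :=
        measure_iUnion_le _
    _ ≤ ∑' i, ENNReal.ofReal (Real.exp (-a i)) * ENNReal.ofReal (Real.exp (-u)) := by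
        refine ENNReal.tsum_le_tsum fun i => ?_
        refine (measure_deviation_le D hN (hf i) hC (hb i) (add_nonneg (ha i) hu)).trans_eq ?_
        rw [← ENNReal.ofReal_mul (Real.exp_nonneg _), ← Real.exp_add]
        congr 2; ring
    _ ≤ ENNReal.ofReal (Real.exp (-u)) := by
        rw [ENNReal.tsum_mul_right]
        exact mul_le_of_le_one_left' hsum

/-! ### Quantiles of the input norm -/

/-- Existence of an upper `t`-quantile of a real random variable. -/
lemma exists_upper_quantile (μ : Measure ℝ) [IsProbabilityMeasure μ] {t : ℝ} (h0 : 0 < t)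
    (h1 : t < 1) : ∃ R : ℝ, μ.real (Set.Ioi R) ≤ t ∧ μ.real (Set.Iio R) ≤ 1 - t := by
  set F := ProbabilityTheory.cdf μ with hF
  have hFr : ∀ x, F x = μ.real (Set.Iic x) := ProbabilityTheory.cdf_eq_real μ
  set s : Set ℝ := {x | 1 - t ≤ F x}
  have hne : s.Nonempty :=
    ((ProbabilityTheory.tendsto_cdf_atTop μ).eventually_const_le (by linarith)).exists
  have hbdd : BddBelow s := by
    obtain ⟨b, hb⟩ :=
      ((ProbabilityTheory.tendsto_cdf_atBot μ).eventually_lt_const (sub_pos.2 h1)).exists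
    refine ⟨b, fun x hx => ?_⟩
    by_contra! h
    exact absurd (hx.trans (F.mono h.le)) (not_le.2 hb)
  refine ⟨sInf s, ?_, ?_⟩
  · have hmem : 1 - t ≤ F (sInf s) := by
      have hc := (F.right_continuous (sInf s)).mono_left
        (nhdsWithin_mono _ Set.Ioi_subset_Ici_self)
      refine ge_of_tendsto (hc : Filter.Tendsto F _ _) ?_
      filter_upwards [self_mem_nhdsWithin] with x hx
      obtain ⟨y, hy, hyx⟩ := exists_lt_of_csInf_lt hne hx
      exact hy.trans (F.mono hyx.le)
    rw [hFr] at hmem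
    rw [← Set.compl_Iic, probReal_compl_eq_one_sub measurableSet_Iic]
    linarith
  -- The open half-line is exhausted by closed ones, each of probability less than `1 - t`.
  · have hlim : Filter.Tendsto (fun n : ℕ => μ.real (Set.Iic (sInf s - 1 / ((n : ℝ) + 1))))
        Filter.atTop (nhds (μ.real (Set.Iio (sInf s)))) := by
      have hU : ⋃ n : ℕ, Set.Iic (sInf s - 1 / ((n : ℝ) + 1)) = Set.Iio (sInf s) := by
        ext x
        simp only [Set.mem_iUnion, Set.mem_Iic, Set.mem_Iio]
        constructor
        · rintro ⟨n, hn⟩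
          have : (0 : ℝ) < 1 / ((n : ℝ) + 1) := by positivity
          linarith
        · intro hx
          obtain ⟨n, hn⟩ := exists_nat_one_div_lt (sub_pos.2 hx)
          exact ⟨n, by linarith⟩
      rw [← hU]
      refine (ENNReal.tendsto_toReal (measure_ne_top _ _)).comp
        (tendsto_measure_iUnion_atTop fun m n hmn => Set.Iic_subset_Iic.2 ?_)
      have : 1 / ((n : ℝ) + 1) ≤ 1 / ((m : ℝ) + 1) := by gcongr
      linarith
    refine le_of_tendsto' hlim fun n => ?_
    rw [← hFr]
    by_contra! h
    have h2 := csInf_le hbdd (show sInf s - 1 / ((n : ℝ) + 1) ∈ s from h.le)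
    have : (0 : ℝ) < 1 / ((n : ℝ) + 1) := by positivity
    linarith

/-- There is a radius `R` outside of which the inputs have probability at most `t`, and which the
largest norm in a sample of size `N` misses with probability at most `exp (-t N)`. -/
lemma exists_radius {E Y : Type*} [NormedAddCommGroup E] [MeasurableSpace E]
    [OpensMeasurableSpace E] [MeasurableSpace Y] (D : Measure (E × Y)) [IsProbabilityMeasure D] (N : ℕ) {t : ℝ}
    (h0 : 0 < t) (h1 : t < 1) :
    ∃ R : ℝ, D.real {z | R < ‖z.1‖} ≤ t ∧
      Measure.pi (fun _ : Fin N => D) {S | ∀ i, ‖(S i).1‖ < R} ≤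
        ENNReal.ofReal (Real.exp (-(t * N))) := by
  have hm : Measurable fun z : E × Y => ‖z.1‖ := by fun_prop
  have : IsProbabilityMeasure (D.map fun z => ‖z.1‖) :=
    Measure.isProbabilityMeasure_map hm.aemeasurable
  obtain ⟨R, hR1, hR2⟩ := exists_upper_quantile (D.map fun z => ‖z.1‖) h0 h1
  rw [map_measureReal_apply hm measurableSet_Ioi] at hR1
  rw [map_measureReal_apply hm measurableSet_Iio] at hR2
  refine ⟨R, hR1, ?_⟩
  have hset : {S : Fin N → E × Y | ∀ i, ‖(S i).1‖ < R}
      = Set.pi Set.univ fun _ => (fun z : E × Y => ‖z.1‖) ⁻¹' Set.Iio R := by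
    ext S; simp
  rw [hset, Measure.pi_pi, Finset.prod_const, Finset.card_univ, Fintype.card_fin,
    ← ENNReal.ofReal_toReal (measure_ne_top D _), ← ENNReal.ofReal_pow ENNReal.toReal_nonneg]
  refine ENNReal.ofReal_le_ofReal ?_
  calc _ ≤ (Real.exp (-t)) ^ N :=
        pow_le_pow_left₀ ENNReal.toReal_nonneg (hR2.trans (Real.one_sub_le_exp_neg t)) N
    _ = _ := by rw [← Real.exp_nat_mul]; congr 1; ring

/-! ### Perturbation of the weight matrices -/

lemma matrixSpectralNorm_nonneg {m n : ℕ} (A : Matrix (Fin m) (Fin n) ℝ) :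
    0 ≤ matrixSpectralNorm A := norm_nonneg _

lemma norm_mulVec_le {m n : ℕ} (A : Matrix (Fin m) (Fin n) ℝ) (v : Fin n → ℝ) :
    ‖WithLp.toLp 2 (A *ᵥ v)‖ ≤ matrixSpectralNorm A * ‖WithLp.toLp 2 v‖ := by
  have := (LinearMap.toContinuousLinearMap (Matrix.toEuclideanLin A)).le_opNorm (WithLp.toLp 2 v)
  simpa [Matrix.toLpLin_apply, matrixSpectralNorm] using this

lemma euclideanNorm_le_of_abs_le {m : ℕ} (v : EuclideanSpace ℝ (Fin m)) {c : ℝ} (hc : 0 ≤ c)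
    (h : ∀ i, |v i| ≤ c) : ‖v‖ ≤ m * c := by
  rw [EuclideanSpace.norm_eq]
  refine Real.sqrt_le_iff.2 ⟨by positivity, ?_⟩
  calc ∑ i, ‖v i‖ ^ 2 ≤ ∑ _i : Fin m, c ^ 2 := Finset.sum_le_sum fun i _ =>
        pow_le_pow_left₀ (norm_nonneg _) (h i) 2
    _ = m * c ^ 2 := by simp
    _ ≤ (m : ℝ) ^ 2 * c ^ 2 := by
        gcongr
        exact_mod_cast Nat.le_self_pow two_ne_zero m
    _ = (m * c) ^ 2 := by ring

/-- A crude comparison of the spectral norm with the largest entry. -/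
lemma matrixSpectralNorm_le_of_abs_le {m n : ℕ} (A : Matrix (Fin m) (Fin n) ℝ) {c : ℝ}
    (hc : 0 ≤ c) (h : ∀ i j, |A i j| ≤ c) : matrixSpectralNorm A ≤ m * n * c := by
  refine ContinuousLinearMap.opNorm_le_bound _ (by positivity) fun v => ?_
  rw [LinearMap.coe_toContinuousLinearMap', Matrix.toLpLin_apply]
  calc _ ≤ m * (n * c * ‖v‖) := by
        refine euclideanNorm_le_of_abs_le _ (by positivity) fun i => ?_
        calc |∑ j, A i j * v j| ≤ ∑ j, |A i j * v j| := Finset.abs_sum_le_sum_abs _ _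
          _ ≤ ∑ _j : Fin n, c * ‖v‖ := by
              refine Finset.sum_le_sum fun j _ => ?_
              rw [abs_mul]
              exact mul_le_mul (h i j) (PiLp.norm_apply_le v j) (abs_nonneg _) hc
          _ = n * c * ‖v‖ := by simp [mul_assoc]
    _ = _ := by ring

lemma matrixSpectralNorm_le_add {m n : ℕ} (A A' : Matrix (Fin m) (Fin n) ℝ) :
    matrixSpectralNorm A' ≤ matrixSpectralNorm A + matrixSpectralNorm (A - A') := by
  unfold matrixSpectralNorm
  rw [map_sub, map_sub]
  exact norm_le_insert _ _

/-- The vector of activations `h_k` after `k` layers. -/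
def layerOutput {L : ℕ} {w : Fin (L + 1) → ℕ} (σ : Fin L → ℝ → ℝ) (A : Weights w)
    (x : EuclideanSpace ℝ (Fin (w 0))) (k : Fin (L + 1)) : Fin (w k) → ℝ :=
  Fin.induction (motive := fun k => Fin (w k) → ℝ) (fun j => x j)
    (fun ℓ h j => layerActivation σ ℓ ((A ℓ *ᵥ h) j)) k

lemma layerOutput_zero {L : ℕ} {w : Fin (L + 1) → ℕ} (σ : Fin L → ℝ → ℝ) (A : Weights w)
    (x : EuclideanSpace ℝ (Fin (w 0))) : layerOutput σ A x 0 = fun j => x j := rfl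

lemma layerOutput_succ {L : ℕ} {w : Fin (L + 1) → ℕ} (σ : Fin L → ℝ → ℝ) (A : Weights w)
    (x : EuclideanSpace ℝ (Fin (w 0))) (ℓ : Fin L) : layerOutput σ A x ℓ.succ =
      fun j => layerActivation σ ℓ ((A ℓ *ᵥ layerOutput σ A x ℓ.castSucc) j) := rfl

section Activation

variable {L : ℕ} {σ : Fin L → ℝ → ℝ} {ρ : Fin L → ℝ≥0}

lemma layerActivation_zero (hσ0 : ∀ ℓ, σ ℓ 0 = 0) (ℓ : Fin L) : layerActivation σ ℓ 0 = 0 := by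
  unfold layerActivation
  split_ifs <;> simp [hσ0]

lemma abs_layerActivation_sub_le (hσ : ∀ ℓ, LipschitzWith (ρ ℓ) (σ ℓ)) (ℓ : Fin L) (a b : ℝ) :
    |layerActivation σ ℓ a - layerActivation σ ℓ b| ≤ (ρ ℓ + 1) * |a - b| := by
  have hρ : (0 : ℝ) ≤ ρ ℓ := (ρ ℓ).2
  have h0 := abs_nonneg (a - b)
  unfold layerActivation
  split_ifs
  · simp only [id]; nlinarith
  · have := (hσ ℓ).dist_le_mul a b
    rw [Real.dist_eq, Real.dist_eq] at this
    nlinarith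

lemma norm_layerActivation_sub_le (hσ : ∀ ℓ, LipschitzWith (ρ ℓ) (σ ℓ)) (ℓ : Fin L) {m : ℕ}
    (u v : Fin m → ℝ) :
    ‖WithLp.toLp 2 (fun j => layerActivation σ ℓ (u j)) -
        WithLp.toLp 2 (fun j => layerActivation σ ℓ (v j))‖ ≤
      (ρ ℓ + 1) * ‖WithLp.toLp 2 u - WithLp.toLp 2 v‖ := by
  have hρ : (0 : ℝ) ≤ ρ ℓ := (ρ ℓ).2
  rw [EuclideanSpace.norm_eq, EuclideanSpace.norm_eq]
  refine Real.sqrt_le_iff.2 ⟨by positivity, ?_⟩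
  rw [mul_pow, Real.sq_sqrt (by positivity), Finset.mul_sum]
  refine Finset.sum_le_sum fun j _ => ?_
  rw [← mul_pow]
  exact pow_le_pow_left₀ (norm_nonneg _) (abs_layerActivation_sub_le hσ ℓ (u j) (v j)) 2

/-- The factor contributed by one layer to `Γ_R`. -/
noncomputable def layerFactor {w : Fin (L + 1) → ℕ} (ρ : Fin L → ℝ≥0) (A : Weights w)
    (ℓ : Fin L) : ℝ :=
  ((ρ ℓ : ℝ) + 1) * (matrixSpectralNorm (A ℓ) + 2) + 1

lemma three_le_layerFactor {w : Fin (L + 1) → ℕ} (A : Weights w) (ℓ : Fin L) :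
    3 ≤ layerFactor ρ A ℓ := by
  have hρ : (0 : ℝ) ≤ ρ ℓ := (ρ ℓ).2
  have := matrixSpectralNorm_nonneg (A ℓ)
  unfold layerFactor
  nlinarith [mul_nonneg hρ this]

lemma partialProd_layerFactor_nonneg {w : Fin (L + 1) → ℕ} (A : Weights w) (k : Fin (L + 1)) :
    0 ≤ Fin.partialProd (layerFactor ρ A) k := by
  induction k using Fin.induction with
  | zero => simp
  | succ ℓ ih =>
    rw [Fin.partialProd_succ]
    exact mul_nonneg ih (by linarith [three_le_layerFactor (ρ := ρ) A ℓ])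

lemma norm_layerOutput_le {w : Fin (L + 1) → ℕ} (hσ : ∀ ℓ, LipschitzWith (ρ ℓ) (σ ℓ))
    (hσ0 : ∀ ℓ, σ ℓ 0 = 0) (A : Weights w) (x : EuclideanSpace ℝ (Fin (w 0))) (k : Fin (L + 1)) :
    ‖WithLp.toLp 2 (layerOutput σ A x k)‖ ≤ ‖x‖ * Fin.partialProd (layerFactor ρ A) k := by
  induction k using Fin.induction with
  | zero => simp [layerOutput_zero]
  | succ ℓ ih =>
    have hρ : (0 : ℝ) ≤ ρ ℓ := (ρ ℓ).2
    have hn := matrixSpectralNorm_nonneg (A ℓ)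
    rw [layerOutput_succ, Fin.partialProd_succ]
    have h := norm_layerActivation_sub_le hσ ℓ (A ℓ *ᵥ layerOutput σ A x ℓ.castSucc) 0
    have h0 : WithLp.toLp 2 (fun j : Fin (w ℓ.succ) =>
        layerActivation σ ℓ ((0 : Fin (w ℓ.succ) → ℝ) j)) = 0 := by
      ext j; simp [layerActivation_zero hσ0]
    rw [h0, WithLp.toLp_zero, sub_zero, sub_zero] at h
    have hc : (ρ ℓ + 1) * matrixSpectralNorm (A ℓ) ≤ layerFactor ρ A ℓ := by
      unfold layerFactor; nlinarith
    calc _ ≤ (ρ ℓ + 1) * (matrixSpectralNorm (A ℓ) *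
          ‖WithLp.toLp 2 (layerOutput σ A x ℓ.castSucc)‖) :=
          h.trans (mul_le_mul_of_nonneg_left (norm_mulVec_le _ _) (by positivity))
      _ = ((ρ ℓ + 1) * matrixSpectralNorm (A ℓ)) *
          ‖WithLp.toLp 2 (layerOutput σ A x ℓ.castSucc)‖ := by ring
      _ ≤ layerFactor ρ A ℓ * (‖x‖ * Fin.partialProd (layerFactor ρ A) ℓ.castSucc) :=
          mul_le_mul hc ih (norm_nonneg _) (by linarith [three_le_layerFactor (ρ := ρ) A ℓ])
      _ = _ := by ring

/-- Perturbing every weight matrix by at most `θ ≤ 1` in spectral norm moves the `k`-th layer by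
at most `k θ ‖x‖` times the product of the first `k` layer factors. -/
lemma norm_layerOutput_sub_le {w : Fin (L + 1) → ℕ} (hσ : ∀ ℓ, LipschitzWith (ρ ℓ) (σ ℓ))
    (hσ0 : ∀ ℓ, σ ℓ 0 = 0) {A A' : Weights w} {θ : ℝ} (hθ0 : 0 ≤ θ) (hθ1 : θ ≤ 1)
    (hA : ∀ ℓ, matrixSpectralNorm (A ℓ - A' ℓ) ≤ θ)
    (x : EuclideanSpace ℝ (Fin (w 0))) (k : Fin (L + 1)) :
    ‖WithLp.toLp 2 (layerOutput σ A x k) - WithLp.toLp 2 (layerOutput σ A' x k)‖ ≤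
      (k : ℕ) * θ * ‖x‖ * Fin.partialProd (layerFactor ρ A) k := by
  induction k using Fin.induction with
  | zero => simp [layerOutput_zero]
  | succ ℓ ih =>
    have hρ : (0 : ℝ) ≤ ρ ℓ := (ρ ℓ).2
    have hn := matrixSpectralNorm_nonneg (A ℓ)
    have hn' := matrixSpectralNorm_nonneg (A' ℓ)
    have hA' : matrixSpectralNorm (A' ℓ) ≤ matrixSpectralNorm (A ℓ) + 1 :=
      (matrixSpectralNorm_le_add (A ℓ) (A' ℓ)).trans (by linarith [hA ℓ])
    have hP := partialProd_layerFactor_nonneg (ρ := ρ) A ℓ.castSucc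
    have hout := norm_layerOutput_le (ρ := ρ) hσ hσ0 A x ℓ.castSucc
    set P := Fin.partialProd (layerFactor ρ A) ℓ.castSucc
    set h := layerOutput σ A x ℓ.castSucc
    set h' := layerOutput σ A' x ℓ.castSucc
    have hsplit : ‖WithLp.toLp 2 (A ℓ *ᵥ h) - WithLp.toLp 2 (A' ℓ *ᵥ h')‖ ≤
        θ * (‖x‖ * P) + (matrixSpectralNorm (A ℓ) + 1) * ((ℓ : ℕ) * θ * ‖x‖ * P) := by
      have e : WithLp.toLp 2 (A ℓ *ᵥ h) - WithLp.toLp 2 (A' ℓ *ᵥ h') =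
          WithLp.toLp 2 ((A ℓ - A' ℓ) *ᵥ h) + WithLp.toLp 2 (A' ℓ *ᵥ (h - h')) := by
        rw [Matrix.sub_mulVec, Matrix.mulVec_sub, WithLp.toLp_sub, WithLp.toLp_sub]; abel
      rw [e]
      refine (norm_add_le _ _).trans (add_le_add ?_ ?_)
      · exact (norm_mulVec_le _ _).trans (mul_le_mul (hA ℓ) hout (norm_nonneg _) hθ0)
      · refine (norm_mulVec_le _ _).trans (mul_le_mul hA' ?_ (norm_nonneg _) (by positivity))
        simpa [WithLp.toLp_sub] using ih
    rw [layerOutput_succ, layerOutput_succ, Fin.partialProd_succ]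
    calc _ ≤ (ρ ℓ + 1) * (θ * (‖x‖ * P) +
          (matrixSpectralNorm (A ℓ) + 1) * ((ℓ : ℕ) * θ * ‖x‖ * P)) :=
          (norm_layerActivation_sub_le hσ ℓ _ _).trans
            (mul_le_mul_of_nonneg_left hsplit (by positivity))
      _ = (θ * ‖x‖ * P) * ((ρ ℓ + 1) + (ρ ℓ + 1) * (matrixSpectralNorm (A ℓ) + 1) * (ℓ : ℕ)) := by
          ring
      _ ≤ (θ * ‖x‖ * P) * (((ℓ : ℕ) + 1) * layerFactor ρ A ℓ) := by
          refine mul_le_mul_of_nonneg_left ?_ (by positivity)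
          have hk : (0 : ℝ) ≤ ((ℓ : ℕ) : ℝ) := by positivity
          unfold layerFactor
          nlinarith [mul_nonneg hρ hn, mul_nonneg hk hρ, mul_nonneg hk hn]
      _ = _ := by simp only [Fin.val_succ]; push_cast; ring

lemma partialProd_last {M : Type*} [CommMonoid M] (f : Fin L → M) :
    Fin.partialProd f (Fin.last L) = ∏ i, f i := by
  rw [Fin.partialProd, List.take_of_length_le (by simp), List.prod_ofFn]

lemma norm_network_sub_le {w : Fin (L + 1) → ℕ} (hσ : ∀ ℓ, LipschitzWith (ρ ℓ) (σ ℓ))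
    (hσ0 : ∀ ℓ, σ ℓ 0 = 0) {A A' : Weights w} {θ : ℝ} (hθ0 : 0 ≤ θ) (hθ1 : θ ≤ 1)
    (hA : ∀ ℓ, matrixSpectralNorm (A ℓ - A' ℓ) ≤ θ) (x : EuclideanSpace ℝ (Fin (w 0))) :
    ‖network σ A x - network σ A' x‖ ≤ L * θ * ‖x‖ * ∏ ℓ, layerFactor ρ A ℓ := by
  have h := norm_layerOutput_sub_le (ρ := ρ) hσ hσ0 hθ0 hθ1 hA x (Fin.last L)
  rw [partialProd_last, ← WithLp.toLp_sub, Fin.val_last] at h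
  refine le_trans ?_ h
  refine (pi_norm_le_iff_of_nonneg (norm_nonneg _)).2 fun i => ?_
  exact PiLp.norm_apply_le (WithLp.toLp 2 (layerOutput σ A x (Fin.last L) -
    layerOutput σ A' x (Fin.last L))) i

lemma continuous_network {w : Fin (L + 1) → ℕ} (hσ : ∀ ℓ, LipschitzWith (ρ ℓ) (σ ℓ))
    (A : Weights w) : Continuous (network σ A) := by
  have hact : ∀ ℓ, Continuous (layerActivation σ ℓ) := by
    intro ℓ
    unfold layerActivation
    split_ifs
    exacts [continuous_id, (hσ ℓ).continuous]
  suffices h : ∀ k, Continuous fun x => layerOutput σ A x k from h (Fin.last L)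
  intro k
  induction k using Fin.induction with
  | zero => simp only [layerOutput_zero]; fun_prop
  | succ ℓ ih =>
    simp only [layerOutput_succ]
    refine continuous_pi fun j => (hact ℓ).comp ?_
    exact (continuous_apply j).comp (continuous_const.matrix_mulVec ih)

/-- A network with a vanishing weight matrix is zero, because the activations fix `0`. -/
lemma network_eq_zero_of_weight_eq_zero {w : Fin (L + 1) → ℕ} (hσ0 : ∀ ℓ, σ ℓ 0 = 0)
    {A : Weights w} {ℓ₀ : Fin L} (hA : A ℓ₀ = 0) (x : EuclideanSpace ℝ (Fin (w 0))) :
    network σ A x = 0 := by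
  suffices h : ∀ k : Fin (L + 1), ℓ₀.castSucc < k → layerOutput σ A x k = 0 from
    h _ (Fin.castSucc_lt_last ℓ₀)
  intro k
  induction k using Fin.induction with
  | zero => intro h; exact absurd h (Fin.not_lt_zero _)
  | succ ℓ ih =>
    intro h
    have hmul : A ℓ *ᵥ layerOutput σ A x ℓ.castSucc = 0 := by
      rcases (Fin.castSucc_lt_succ_iff.1 h).eq_or_lt with rfl | hlt
      · rw [hA, Matrix.zero_mulVec]
      · rw [ih (Fin.castSucc_lt_castSucc_iff.2 hlt), Matrix.mulVec_zero]
    rw [layerOutput_succ, hmul]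
    ext j
    simp [layerActivation_zero hσ0]

end Activation

/-! ### Low-rank factorization and discretization -/

/-- A matrix of rank `r` factors through `ℝ^r` with a left factor given by an orthonormal basis of
the range, so that the entries of both factors are controlled. -/
lemma exists_rank_factorization {m n : ℕ} (A : Matrix (Fin m) (Fin n) ℝ) :
    ∃ (U : Matrix (Fin m) (Fin A.rank) ℝ) (V : Matrix (Fin A.rank) (Fin n) ℝ),
      A = U * V ∧ (∀ i k, |U i k| ≤ 1) ∧ ∀ k j, |V k j| ≤ matrixSpectralNorm A := by
  set T := Matrix.toEuclideanLin A with hT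
  have hrank : Module.finrank ℝ (LinearMap.range T) = A.rank := by
    rw [A.rank_eq_finrank_range_toLin (PiLp.basisFun 2 ℝ (Fin m)) (PiLp.basisFun 2 ℝ (Fin n)), hT,
      ← Matrix.toLpLin_eq_toLin]
  set b := (stdOrthonormalBasis ℝ (LinearMap.range T)).reindex (finCongr hrank) with hb
  set y : Fin n → LinearMap.range T := fun j => ⟨T (EuclideanSpace.single j 1), _, rfl⟩ with hy
  have hbn : ∀ k, ‖b k‖ = 1 := b.norm_eq_one
  refine ⟨Matrix.of fun i k => (b k : EuclideanSpace ℝ (Fin m)) i,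
    Matrix.of fun k j => inner ℝ (b k) (y j), ?_, ?_, ?_⟩
  · ext i j
    have h := congrArg (fun v : LinearMap.range T => (v : EuclideanSpace ℝ (Fin m)) i)
      (b.sum_repr' (y j))
    have hA : (y j : EuclideanSpace ℝ (Fin m)) i = A i j := by
      simp [hy, hT, Matrix.toLpLin_apply]
    dsimp only at h
    rw [← hA, ← h, Matrix.mul_apply, Submodule.coe_sum]
    simp [mul_comm]
  · intro i k
    have h := PiLp.norm_apply_le (b k : EuclideanSpace ℝ (Fin m)) i
    rwa [Submodule.norm_coe, hbn] at h
  · intro k j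
    rw [Matrix.of_apply]
    refine (abs_real_inner_le_norm (b k) (y j)).trans ?_
    rw [hbn, one_mul]
    have h := (LinearMap.toContinuousLinearMap T).le_opNorm (EuclideanSpace.single j 1)
    simpa [matrixSpectralNorm, hy] using h

/-- The points of the grid of mesh `2^(-4m)` used to discretize entries; those with codes up to
`2^(5m+1)` fill the interval `[-2^m, 2^m]`. -/
noncomputable def gridValue (m : ℕ) (c : Fin (2 ^ (7 * m))) : ℝ :=
  ((c : ℕ) - 2 ^ (5 * m)) / 2 ^ (4 * m)

/-- The number of codes, `2^(7m)`, is only enough for the whole interval when `m ≥ 1`. -/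
lemma exists_gridValue_close {m : ℕ} (hm : 1 ≤ m) {v : ℝ} (hv : |v| ≤ 2 ^ m) :
    ∃ c, |v - gridValue m c| ≤ 1 / 2 ^ (4 * m) := by
  have h4 : (0 : ℝ) < 2 ^ (4 * m) := by positivity
  have h5 : (2 : ℝ) ^ (5 * m) = 2 ^ m * 2 ^ (4 * m) := by rw [← pow_add]; congr 1; ring
  obtain ⟨hv1, hv2⟩ := abs_le.1 hv
  have hx0 : 0 ≤ v * 2 ^ (4 * m) + 2 ^ (5 * m) := by rw [h5]; nlinarith
  have hx1 : v * 2 ^ (4 * m) + 2 ^ (5 * m) ≤ 2 ^ (5 * m + 1) := by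
    rw [pow_succ, h5]; nlinarith
  have hlt : ⌊v * 2 ^ (4 * m) + 2 ^ (5 * m)⌋₊ < 2 ^ (7 * m) := by
    rw [Nat.floor_lt hx0]
    refine hx1.trans_lt ?_
    push_cast
    exact pow_lt_pow_right₀ one_lt_two (by omega)
  refine ⟨⟨_, hlt⟩, ?_⟩
  have hf1 := Nat.floor_le hx0
  have hf2 := Nat.lt_floor_add_one (v * 2 ^ (4 * m) + 2 ^ (5 * m))
  have e : v - gridValue m ⟨_, hlt⟩ = (v * 2 ^ (4 * m) + 2 ^ (5 * m) -
      (⌊v * 2 ^ (4 * m) + 2 ^ (5 * m)⌋₊ : ℝ)) / 2 ^ (4 * m) := by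
    unfold gridValue
    field_simp
    ring
  rw [e, abs_of_nonneg (by apply div_nonneg _ h4.le; linarith)]
  gcongr
  linarith

section Grid

variable {L : ℕ} {w : Fin (L + 1) → ℕ}

/-- Codes for the weights at level `m` whose `ℓ`-th matrix is a product of grid matrices with inner
dimension `r ℓ`. -/
abbrev GridCode (w : Fin (L + 1) → ℕ) (m : ℕ) (r : Fin L → ℕ) : Type :=
  ∀ ℓ : Fin L, (Fin (w ℓ.succ) → Fin (r ℓ) → Fin (2 ^ (7 * m))) ×
    (Fin (r ℓ) → Fin (w ℓ.castSucc) → Fin (2 ^ (7 * m)))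

/-- The weights with a given code. -/
noncomputable def gridWeights {m : ℕ} {r : Fin L → ℕ} (p : GridCode w m r) : Weights w := fun ℓ =>
  (Matrix.of fun i k => gridValue m ((p ℓ).1 i k)) *
    (Matrix.of fun k j => gridValue m ((p ℓ).2 k j))

lemma card_gridCode (m : ℕ) (r : Fin L → ℕ) : Fintype.card (GridCode w m r) =
    2 ^ (7 * m * ∑ ℓ, (w ℓ.succ + w ℓ.castSucc) * r ℓ) := by
  simp only [Fintype.card_pi, Fintype.card_prod, Finset.prod_const, Finset.card_univ,
    Fintype.card_fin, ← pow_mul, ← pow_add, Finset.prod_pow_eq_pow_sum, Finset.mul_sum]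
  congr 1
  exact Finset.sum_congr rfl fun ℓ _ => by ring

lemma le_maxWidth (k : Fin (L + 1)) : w k ≤ maxWidth w := Finset.le_sup (Finset.mem_univ k)

/-- Rounding the factors of a rank factorization to the grid of mesh `2^(-4m)` changes the weights
by at most `2^(-m)` in spectral norm. -/
lemma exists_gridCode_close (A : Weights w) {m : ℕ} (hm : 1 ≤ m)
    (hA : ∀ ℓ, (maxWidth w : ℝ) * (matrixSpectralNorm (A ℓ) + 2) ≤ 2 ^ m) :
    ∃ p : GridCode w m fun ℓ => (A ℓ).rank, ∀ ℓ,
      matrixSpectralNorm (A ℓ - gridWeights p ℓ) ≤ 1 / 2 ^ m := by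
  suffices h : ∀ ℓ, ∃ p : (Fin (w ℓ.succ) → Fin (A ℓ).rank → Fin (2 ^ (7 * m))) ×
      (Fin (A ℓ).rank → Fin (w ℓ.castSucc) → Fin (2 ^ (7 * m))),
      matrixSpectralNorm (A ℓ - (Matrix.of fun i k => gridValue m (p.1 i k)) *
        (Matrix.of fun k j => gridValue m (p.2 k j))) ≤ 1 / 2 ^ m by
    choose p hp using h
    exact ⟨p, hp⟩
  intro ℓ
  obtain ⟨U, V, hUV, hU, hV⟩ := exists_rank_factorization (A ℓ)
  set s := matrixSpectralNorm (A ℓ)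
  have hs : 0 ≤ s := matrixSpectralNorm_nonneg _
  have h1m : (1 : ℝ) ≤ 2 ^ m := one_le_pow₀ one_le_two
  set η : ℝ := 1 / 2 ^ (4 * m) with hη
  have hη0 : 0 < η := by positivity
  have hη1 : η ≤ 1 := by
    rw [hη, div_le_one (by positivity)]; exact one_le_pow₀ one_le_two
  have hVm : ∀ k j, |V k j| ≤ 2 ^ m := by
    intro k j
    have hpos : 0 < w ℓ.castSucc := Fin.pos j
    have hW : (1 : ℝ) ≤ maxWidth w := by
      exact_mod_cast (Nat.succ_le_of_lt hpos).trans (le_maxWidth ℓ.castSucc)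
    exact (hV k j).trans (le_trans (by nlinarith) (hA ℓ))
  choose cU hcU using fun i k => exists_gridValue_close hm ((hU i k).trans h1m)
  choose cV hcV using fun k j => exists_gridValue_close hm (hVm k j)
  refine ⟨(cU, cV), ?_⟩
  have hw1 : (w ℓ.succ : ℝ) ≤ maxWidth w := by exact_mod_cast le_maxWidth _
  have hw2 : (w ℓ.castSucc : ℝ) ≤ maxWidth w := by exact_mod_cast le_maxWidth _
  have hr : ((A ℓ).rank : ℝ) ≤ maxWidth w := by
    exact_mod_cast ((A ℓ).rank_le_height).trans (le_maxWidth _)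
  have hent : ∀ i j, |(A ℓ - (Matrix.of fun i k => gridValue m (cU i k)) *
      (Matrix.of fun k j => gridValue m (cV k j))) i j| ≤ (A ℓ).rank * (η * (s + 2)) := by
    intro i j
    have e : (A ℓ - (Matrix.of fun i k => gridValue m (cU i k)) *
        (Matrix.of fun k j => gridValue m (cV k j))) i j =
        ∑ k, (U i k * V k j - gridValue m (cU i k) * gridValue m (cV k j)) := by
      rw [Matrix.sub_apply, Finset.sum_sub_distrib]
      congr 1
      exact congrFun (congrFun hUV i) j
    rw [e]
    refine (Finset.abs_sum_le_sum_abs _ _).trans ?_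
    calc _ ≤ ∑ _k : Fin (A ℓ).rank, η * (s + 2) := by
          refine Finset.sum_le_sum fun k _ => ?_
          have e2 : U i k * V k j - gridValue m (cU i k) * gridValue m (cV k j) =
              (U i k - gridValue m (cU i k)) * V k j
              + U i k * (V k j - gridValue m (cV k j))
              - (U i k - gridValue m (cU i k)) * (V k j - gridValue m (cV k j)) := by ring
          rw [e2]
          have t1 : |(U i k - gridValue m (cU i k)) * V k j| ≤ η * s := by
            rw [abs_mul]; exact mul_le_mul (hcU i k) (hV k j) (abs_nonneg _) hη0.le
          have t2 : |U i k * (V k j - gridValue m (cV k j))| ≤ 1 * η := by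
            rw [abs_mul]; exact mul_le_mul (hU i k) (hcV k j) (abs_nonneg _) zero_le_one
          have t3 : |(U i k - gridValue m (cU i k)) * (V k j - gridValue m (cV k j))| ≤ η * 1 := by
            rw [abs_mul]
            exact mul_le_mul (hcU i k) ((hcV k j).trans hη1) (abs_nonneg _) hη0.le
          have t4 := abs_sub ((U i k - gridValue m (cU i k)) * V k j
              + U i k * (V k j - gridValue m (cV k j)))
              ((U i k - gridValue m (cU i k)) * (V k j - gridValue m (cV k j)))
          have t5 := abs_add_le ((U i k - gridValue m (cU i k)) * V k j)
              (U i k * (V k j - gridValue m (cV k j)))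
          linarith
      _ = _ := by simp
  refine (matrixSpectralNorm_le_of_abs_le _ (by positivity) hent).trans ?_
  have hWm : (maxWidth w : ℝ) ≤ 2 ^ m := by
    refine le_trans ?_ (hA ℓ)
    nlinarith [Nat.cast_nonneg (α := ℝ) (maxWidth w)]
  calc (w ℓ.succ : ℝ) * w ℓ.castSucc * ((A ℓ).rank * (η * (s + 2)))
      ≤ maxWidth w * maxWidth w * (maxWidth w * (η * (s + 2))) := by gcongr
    _ = maxWidth w * maxWidth w * (maxWidth w * (s + 2)) * η := by ring
    _ ≤ 2 ^ m * 2 ^ m * 2 ^ m * η := by gcongr; exact hA ℓ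
    _ = 1 / 2 ^ m := by
        rw [hη, show 4 * m = m + m + m + m by ring, pow_add, pow_add, pow_add]
        field_simp

/-- Codes of all levels and all inner dimensions up to the maximal width. -/
abbrev GridIndex (w : Fin (L + 1) → ℕ) : Type :=
  Σ k : ℕ × (Fin L → Fin (maxWidth w + 1)), GridCode w k.1 fun ℓ => (k.2 ℓ : ℕ)

/-- The negative logarithm of the prior weight
`2^(-(m+1)) (W+1)^(-L) 2^(-7 m ∑ (w_ℓ + w_{ℓ-1}) r_ℓ)` of a code. -/
noncomputable def gridCost (i : GridIndex w) : ℝ :=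
  Real.log 2 * (7 * i.1.1 * ∑ ℓ, ((w ℓ.succ : ℝ) + w ℓ.castSucc) * (i.1.2 ℓ : ℕ)) +
    (Real.log 2 * (i.1.1 + 1) + L * Real.log (maxWidth w + 1))

lemma gridCost_nonneg (i : GridIndex w) : 0 ≤ gridCost i := by
  have h1 : 0 ≤ Real.log 2 := Real.log_nonneg one_le_two
  have h2 : 0 ≤ Real.log ((maxWidth w : ℝ) + 1) := Real.log_nonneg (by simp)
  unfold gridCost
  positivity

lemma tsum_exp_neg_gridCost_le :
    ∑' i : GridIndex w, ENNReal.ofReal (Real.exp (-gridCost i)) ≤ 1 := by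
  have hexp2 : ∀ n : ℕ, Real.exp (-(Real.log 2 * n)) = (1 / 2) ^ n := by
    intro n
    rw [mul_comm, ← mul_neg, Real.exp_nat_mul, Real.exp_neg, Real.exp_log two_pos, one_div]
  have hW : (0 : ℝ) < (maxWidth w : ℝ) + 1 := by positivity
  have hterm : ∀ (k : ℕ × (Fin L → Fin (maxWidth w + 1)))
      (p : GridCode w k.1 fun ℓ => (k.2 ℓ : ℕ)),
      Real.exp (-gridCost (⟨k, p⟩ : GridIndex w)) =
        (1 / 2) ^ (7 * k.1 * ∑ ℓ, (w ℓ.succ + w ℓ.castSucc) * (k.2 ℓ : ℕ)) *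
          ((1 / 2) ^ (k.1 + 1) * (((maxWidth w : ℝ) + 1) ^ L)⁻¹) := by
    intro k p
    rw [← hexp2, ← hexp2, ← Real.exp_log hW, ← Real.exp_nat_mul, ← Real.exp_neg, ← Real.exp_add,
      ← Real.exp_add]
    congr 1
    unfold gridCost
    push_cast
    ring
  rw [ENNReal.tsum_sigma']
  have hin : ∀ k : ℕ × (Fin L → Fin (maxWidth w + 1)),
      ∑' p : GridCode w k.1 fun ℓ => (k.2 ℓ : ℕ),
        ENNReal.ofReal (Real.exp (-gridCost (⟨k, p⟩ : GridIndex w))) =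
      ENNReal.ofReal ((1 / 2) ^ (k.1 + 1) * (((maxWidth w : ℝ) + 1) ^ L)⁻¹) := by
    intro k
    simp_rw [hterm]
    rw [tsum_fintype, Finset.sum_const, Finset.card_univ, card_gridCode, nsmul_eq_mul,
      ← ENNReal.ofReal_natCast, ← ENNReal.ofReal_mul (by positivity), ← mul_assoc]
    congr 1
    push_cast
    rw [← mul_pow]
    norm_num
  simp_rw [hin]
  rw [ENNReal.tsum_prod (f := fun (m : ℕ) (_ : Fin L → Fin (maxWidth w + 1)) =>
    ENNReal.ofReal ((1 / 2) ^ (m + 1) * (((maxWidth w : ℝ) + 1) ^ L)⁻¹))]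
  have hr : ∀ m : ℕ, ∑' _r : Fin L → Fin (maxWidth w + 1),
      ENNReal.ofReal ((1 / 2) ^ (m + 1) * (((maxWidth w : ℝ) + 1) ^ L)⁻¹) =
      ENNReal.ofReal ((1 / 2) ^ (m + 1)) := by
    intro m
    rw [tsum_fintype, Finset.sum_const, Finset.card_univ, nsmul_eq_mul,
      ← ENNReal.ofReal_natCast, ← ENNReal.ofReal_mul (by positivity)]
    congr 1
    simp only [Fintype.card_pi, Fintype.card_fin, Finset.prod_const, Finset.card_univ]
    push_cast
    field_simp
  simp_rw [hr]
  have hs : HasSum (fun m : ℕ => ((1 : ℝ) / 2) ^ (m + 1)) 1 := by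
    have := hasSum_geometric_two.mul_left (1 / 2)
    simpa [pow_succ, mul_comm] using this
  rw [← ENNReal.ofReal_tsum_of_nonneg (fun m => by positivity) hs.summable, hs.tsum_eq]
  simp

end Grid

/-! ### Approximating a network by a discretized one -/

section Approximation

variable {L : ℕ} {w : Fin (L + 1) → ℕ}

lemma one_le_rank_of_ne_zero {m n : ℕ} {A : Matrix (Fin m) (Fin n) ℝ} (hA : A ≠ 0) :
    1 ≤ A.rank := by
  by_contra! h
  obtain ⟨U, V, hUV, -, -⟩ := exists_rank_factorization A
  have : IsEmpty (Fin A.rank) := by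
    rw [Nat.lt_one_iff.1 h]; infer_instance
  refine hA (hUV.trans ?_)
  ext i j
  simp [Matrix.mul_apply]

lemma rankComplexity_nonneg (A : Weights w) : 0 ≤ rankComplexity A :=
  Finset.sum_nonneg fun _ _ => by positivity

lemma two_mul_depth_le_rankComplexity {A : Weights w} (hA : ∀ ℓ, A ℓ ≠ 0) :
    2 * (L : ℝ) ≤ rankComplexity A := by
  have h : ∑ _ℓ : Fin L, (2 : ℝ) ≤ rankComplexity A := by
    refine Finset.sum_le_sum fun ℓ _ => ?_
    have h0 := one_le_rank_of_ne_zero (hA ℓ)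
    have h1 : 1 ≤ w ℓ.succ := h0.trans (A ℓ).rank_le_height
    have h2 : 1 ≤ w ℓ.castSucc := h0.trans (A ℓ).rank_le_width
    have : 2 ≤ (w ℓ.succ + w ℓ.castSucc) * (A ℓ).rank := by nlinarith
    exact_mod_cast this
  simpa [mul_comm] using h

lemma layerFactor_le_prod (ρ : Fin L → ℝ≥0) (A : Weights w) (ℓ : Fin L) :
    layerFactor ρ A ℓ ≤ ∏ i, layerFactor ρ A i := by
  have h3 : ∀ i, 3 ≤ layerFactor ρ A i := three_le_layerFactor A
  rw [← Finset.mul_prod_erase _ _ (Finset.mem_univ ℓ)]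
  refine le_mul_of_one_le_right (by linarith [h3 ℓ]) ?_
  calc (1 : ℝ) = ∏ _i ∈ Finset.univ.erase ℓ, (1 : ℝ) := by simp
    _ ≤ _ := Finset.prod_le_prod (fun _ _ => zero_le_one) fun i _ => by linarith [h3 i]

lemma gammaR_eq (N : ℕ) (lip : ℝ≥0) (ρ : Fin L → ℝ≥0) (b : ℝ) (A : Weights w) :
    gammaR N lip ρ b A =
      (b + 2) * (L * lip + 1) * maxWidth w * N * ∏ ℓ, layerFactor ρ A ℓ := rfl

/-- Networks without vanishing weight matrices are approximated on the ball of radius `b`, up to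
`1/N` in loss, by a discretized network whose cost is of the order of the number of parameters
`∑ (w_ℓ + w_{ℓ-1}) rank A_ℓ` times `log Γ_R`. -/
lemma exists_gridIndex_close (hL : 1 ≤ L) {σ : Fin L → ℝ → ℝ} {ρ : Fin L → ℝ≥0}
    (hσ : ∀ ℓ, LipschitzWith (ρ ℓ) (σ ℓ)) (hσ0 : ∀ ℓ, σ ℓ 0 = 0) {lip : ℝ≥0} {N : ℕ} (hN : 1 ≤ N)
    {A : Weights w} (hA : ∀ ℓ, A ℓ ≠ 0) {b : ℝ} (hb : 0 ≤ b) :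
    ∃ i : GridIndex w,
      gridCost i ≤ 9 * (rankComplexity A * Real.logb 2 (4 * gammaR N lip ρ b A)) ∧
      ∀ x : EuclideanSpace ℝ (Fin (w 0)), ‖x‖ ≤ b →
        lip * ‖network σ A x - network σ (gridWeights i.2) x‖ ≤ 1 / N := by
  have hLR : (1 : ℝ) ≤ L := by exact_mod_cast hL
  have hNR : (1 : ℝ) ≤ N := by exact_mod_cast hN
  have hlip : (0 : ℝ) ≤ lip := lip.2
  have hW : (1 : ℝ) ≤ maxWidth w := by
    have h1 : 1 ≤ w (⟨0, hL⟩ : Fin L).succ :=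
      (one_le_rank_of_ne_zero (hA ⟨0, hL⟩)).trans (A _).rank_le_height
    exact_mod_cast h1.trans (le_maxWidth _)
  have h3 : ∀ i, 3 ≤ layerFactor ρ A i := three_le_layerFactor A
  have hP : ∀ ℓ, layerFactor ρ A ℓ ≤ ∏ i, layerFactor ρ A i := layerFactor_le_prod ρ A
  have hPn : ∀ ℓ, matrixSpectralNorm (A ℓ) + 2 ≤ ∏ i, layerFactor ρ A i := by
    intro ℓ
    refine le_trans ?_ (hP ℓ)
    have h1 : (0 : ℝ) ≤ ρ ℓ := (ρ ℓ).2
    have h2 := matrixSpectralNorm_nonneg (A ℓ)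
    unfold layerFactor
    nlinarith [mul_nonneg h1 h2]
  have hP3 : 3 ≤ ∏ i, layerFactor ρ A i := (h3 ⟨0, hL⟩).trans (hP _)
  have hΓ := gammaR_eq N lip ρ b A
  set Γ := gammaR N lip ρ b A
  set P := ∏ i, layerFactor ρ A i
  have hLl : (0 : ℝ) ≤ L * lip := by positivity
  have hΓ2 : 2 * (maxWidth w * P) ≤ Γ := by
    have h1 : 2 * 1 ≤ (b + 2) * (L * lip + 1) :=
      mul_le_mul (by linarith) (by linarith) zero_le_one (by linarith)
    have h2 : maxWidth w * P ≤ maxWidth w * P * N := le_mul_of_one_le_right (by positivity) hNR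
    calc 2 * (maxWidth w * P) ≤ ((b + 2) * (L * lip + 1)) * (maxWidth w * P * N) :=
          mul_le_mul (by linarith) h2 (by positivity) (by positivity)
      _ = Γ := by rw [hΓ]; ring
  have hWP : (maxWidth w : ℝ) * 3 ≤ maxWidth w * P := mul_le_mul_of_nonneg_left hP3 (by linarith)
  have hΓ6 : 6 ≤ Γ := by linarith
  have hlog : 0 < Real.logb 2 Γ := Real.logb_pos one_lt_two (by linarith)
  set m := ⌈Real.logb 2 Γ⌉₊
  have hm1 : 1 ≤ m := Nat.ceil_pos.2 hlog
  have hΓm : Γ ≤ 2 ^ m := by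
    rw [← Real.rpow_natCast, ← Real.logb_le_iff_le_rpow one_lt_two (by linarith)]
    exact Nat.le_ceil _
  have hmΓ : (m : ℝ) ≤ Real.logb 2 (4 * Γ) := by
    have h1 := Nat.ceil_lt_add_one hlog.le
    have h4 : Real.logb 2 4 = 2 := by
      rw [show (4 : ℝ) = 2 ^ (2 : ℝ) by norm_num, Real.logb_rpow two_pos (by norm_num)]
    rw [Real.logb_mul (by norm_num) (by linarith), h4]
    linarith
  have hWn : ∀ ℓ, (maxWidth w : ℝ) * (matrixSpectralNorm (A ℓ) + 2) ≤ 2 ^ m := by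
    intro ℓ
    have := mul_le_mul_of_nonneg_left (hPn ℓ) (by linarith : (0 : ℝ) ≤ maxWidth w)
    linarith
  obtain ⟨p, hp⟩ := exists_gridCode_close A hm1 hWn
  refine ⟨⟨(m, fun ℓ => ⟨(A ℓ).rank,
    Nat.lt_succ_of_le ((A ℓ).rank_le_height.trans (le_maxWidth _))⟩), p⟩, ?_, ?_⟩
  · have hm1R : (1 : ℝ) ≤ m := by exact_mod_cast hm1
    have hK := two_mul_depth_le_rankComplexity hA
    have hl1 : Real.log 2 ≤ 1 := by linarith [Real.log_two_lt_d9]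
    have hl0 : 0 ≤ Real.log 2 := Real.log_nonneg one_le_two
    have hlW : Real.log (maxWidth w + 1) ≤ m := by
      calc Real.log (maxWidth w + 1) ≤ Real.log (2 ^ m) :=
            Real.log_le_log (by positivity) (by linarith)
        _ = m * Real.log 2 := by rw [Real.log_pow]
        _ ≤ m * 1 := by gcongr
        _ = m := mul_one _
    have e1 : Real.log 2 * (7 * m * rankComplexity A) ≤ 7 * m * rankComplexity A :=
      mul_le_of_le_one_left (mul_nonneg (by positivity) (rankComplexity_nonneg A)) hl1
    have e2 : Real.log 2 * (m + 1) ≤ m + 1 := mul_le_of_le_one_left (by positivity) hl1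
    have e3 : L * Real.log (maxWidth w + 1) ≤ L * m := by gcongr
    have e4 : (m : ℝ) * (2 * L) ≤ m * rankComplexity A := by gcongr
    have e5 : (m : ℝ) * 1 ≤ m * L := by gcongr
    calc _ = Real.log 2 * (7 * m * rankComplexity A) +
          (Real.log 2 * (m + 1) + L * Real.log (maxWidth w + 1)) := rfl
      _ ≤ 9 * (rankComplexity A * m) := by linarith
      _ ≤ 9 * (rankComplexity A * Real.logb 2 (4 * Γ)) := by
          have := rankComplexity_nonneg A
          gcongr
  · intro x hx
    have h2m : (0 : ℝ) < 2 ^ m := by positivity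
    have h := norm_network_sub_le hσ hσ0 (A := A) (A' := gridWeights p) (by positivity)
      ((div_le_one h2m).2 (one_le_pow₀ one_le_two)) hp x
    refine (mul_le_mul_of_nonneg_left h hlip).trans ?_
    have hfac : N * (L * lip * b * P) ≤ Γ := by
      calc N * (L * lip * b * P) = (b * (L * lip)) * 1 * N * P := by ring
        _ ≤ ((b + 2) * (L * lip + 1)) * maxWidth w * N * P := by
            gcongr <;> linarith
        _ = Γ := hΓ.symm
    rw [le_div_iff₀ (by linarith)]
    calc lip * (L * (1 / 2 ^ m) * ‖x‖ * P) * N ≤ lip * (L * (1 / 2 ^ m) * b * P) * N := by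
          have : 0 ≤ P := by linarith
          gcongr
      _ = N * (L * lip * b * P) / 2 ^ m := by field_simp
      _ ≤ 1 := by rw [div_le_one h2m]; linarith

end Approximation

/-! ### The generalization bound -/

section Gap

variable {E Y : Type*} [NormedAddCommGroup E] [MeasurableSpace E] [OpensMeasurableSpace E]
  [MeasurableSpace Y]

/-- If the bounded function `g` is within `ε` of `f` on the ball of radius `r ≥ R` and `r` bounds
the norms of the sample, then the deviation of `g` exceeds the deviation of `f`, truncated to the
ball of radius `R`, by at most `2 ε` plus the contribution of the inputs of norm larger than `R`. -/
lemma deviation_le_of_close (D : Measure (E × Y)) [IsProbabilityMeasure D] {N : ℕ} (hN : 1 ≤ N)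
    {f g : E × Y → ℝ} {B ε R r : ℝ} (hf : Measurable f) (hg : Measurable g)
    (hf0 : ∀ z, 0 ≤ f z ∧ f z ≤ B) (hg0 : ∀ z, 0 ≤ g z ∧ g z ≤ B) (hε : 0 ≤ ε) (hRr : R ≤ r)
    (hclose : ∀ z : E × Y, ‖z.1‖ ≤ r → |g z - f z| ≤ ε) {S : Fin N → E × Y}
    (hS : ∀ i, ‖(S i).1‖ ≤ r) :
    (∫ z, g z ∂D) - (1 / (N : ℝ)) * ∑ i, g (S i) ≤
      ((∫ z, {z : E × Y | ‖z.1‖ ≤ R}.indicator f z ∂D) -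
        (1 / (N : ℝ)) * ∑ i, {z : E × Y | ‖z.1‖ ≤ R}.indicator f (S i)) +
      (2 * ε + B * D.real {z | R < ‖z.1‖}) := by
  have hN' : (0 : ℝ) < N := by exact_mod_cast hN
  have hm : Measurable fun z : E × Y => ‖z.1‖ := by fun_prop
  have hball : MeasurableSet {z : E × Y | ‖z.1‖ ≤ R} := measurableSet_le hm measurable_const
  have hout : MeasurableSet {z : E × Y | R < ‖z.1‖} := measurableSet_lt measurable_const hm
  have hfint : Integrable f D := .of_mem_Icc 0 B hf.aemeasurable (.of_forall fun z => hf0 z)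
  have hgint : Integrable g D := .of_mem_Icc 0 B hg.aemeasurable (.of_forall fun z => hg0 z)
  have hpop : ∫ z, g z ∂D ≤ (∫ z, {z : E × Y | ‖z.1‖ ≤ R}.indicator f z ∂D) + ε +
      B * D.real {z | R < ‖z.1‖} := by
    have hi1 := hfint.indicator hball
    have hi2 : Integrable ({z : E × Y | R < ‖z.1‖}.indicator fun _ => B) D :=
      (integrable_const B).indicator hout
    calc ∫ z, g z ∂D ≤ ∫ z, (({z : E × Y | ‖z.1‖ ≤ R}.indicator f z + ε) +
          {z : E × Y | R < ‖z.1‖}.indicator (fun _ => B) z) ∂D := by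
          refine integral_mono hgint ((hi1.add (integrable_const ε)).add hi2) fun z => ?_
          by_cases hz : ‖z.1‖ ≤ R
          · have h1 := (abs_le.1 (hclose z (hz.trans hRr))).2
            simp only [Set.indicator, Set.mem_ofPred_eq, hz, if_true, not_lt.2 hz, if_false]
            linarith
          · have h1 := (hg0 z).2
            simp only [Set.indicator, Set.mem_ofPred_eq, hz, if_false, not_le.1 hz, if_true]
            linarith
      _ = _ := by
          have hi3 : Integrable (fun z => {z : E × Y | ‖z.1‖ ≤ R}.indicator f z + ε) D :=
            hi1.add (integrable_const ε)
          rw [integral_add hi3 hi2, integral_add hi1 (integrable_const ε),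
            integral_indicator_const B hout]
          simp [mul_comm]
  have hemp : ∑ i, {z : E × Y | ‖z.1‖ ≤ R}.indicator f (S i) ≤ ∑ i, g (S i) + N * ε := by
    calc _ ≤ ∑ i, (g (S i) + ε) := by
          refine Finset.sum_le_sum fun i _ => ?_
          have h1 := (abs_le.1 (hclose (S i) (hS i))).1
          have h2 := Set.indicator_le_self' (s := {z : E × Y | ‖z.1‖ ≤ R}) (f := f)
            (fun z _ => (hf0 z).1) (S i)
          linarith
      _ = _ := by simp [Finset.sum_add_distrib]
  have hemp' := mul_le_mul_of_nonneg_left hemp (one_div_pos.2 hN').le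
  have e : 1 / (N : ℝ) * (∑ i, g (S i) + N * ε) = 1 / (N : ℝ) * ∑ i, g (S i) + ε := by
    field_simp
  linarith

end Gap

/-- The numerical comparison of the union bound with the claimed rate; here `u = log (4 / δ)` and
`k` is the number of parameters times `log₂ (4 Γ_R)`. -/
lemma rate_le {B u N a k : ℝ} (hB : 0 ≤ B) (hu : 1 ≤ u) (huN : u ≤ N) (hN : 2 ≤ N) (hk : 0 ≤ k)
    (ha : a ≤ 9 * k) :
    (B + 1) * √((a + u) / (2 * N)) + (2 * (1 / N) + B * (u / N)) ≤
      6 * (B + 1) * √(u / N) + 240 * √k * Real.log N * (B + 1) / √N := by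
  have hN0 : 0 < N := by linarith
  have hlog : 1 / 80 ≤ Real.log N := by
    have := Real.log_le_log two_pos hN
    linarith [Real.log_two_gt_d9]
  have hx0 : 0 ≤ u / N := by positivity
  have hx1 : u / N ≤ 1 := (div_le_one hN0).2 huN
  have hs0 := Real.sqrt_nonneg (u / N)
  have h1 : u / N ≤ √(u / N) := Real.le_sqrt_of_sq_le (by nlinarith)
  have h2 : 1 / N ≤ √(u / N) := le_trans (by gcongr) h1
  have h3 : √((a + u) / (2 * N)) ≤ 3 * √k / √N + √(u / N) := by
    have e : 3 * √k / √N = √(9 * k / N) := by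
      rw [Real.sqrt_div (by positivity), Real.sqrt_mul (by norm_num),
        show (9 : ℝ) = 3 ^ 2 by norm_num, Real.sqrt_sq (by norm_num)]
    rw [e]
    have hsub : √(9 * k / N + u / N) ≤ √(9 * k / N) + √(u / N) := by
      have hy0 : 0 ≤ 9 * k / N := by positivity
      refine Real.sqrt_le_iff.2 ⟨by positivity, ?_⟩
      nlinarith [Real.sq_sqrt hy0, Real.sq_sqrt hx0, mul_nonneg (Real.sqrt_nonneg (9 * k / N)) hs0]
    refine le_trans (Real.sqrt_le_sqrt ?_) hsub
    rw [← add_div]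
    calc (a + u) / (2 * N) ≤ (9 * k + u) / (2 * N) := by gcongr
      _ ≤ (9 * k + u) / N := by gcongr; linarith
  have h4 : 3 * √k / √N ≤ 240 * √k * Real.log N / √N := by
    refine div_le_div_of_nonneg_right ?_ (Real.sqrt_nonneg N)
    nlinarith [mul_le_mul_of_nonneg_left hlog (Real.sqrt_nonneg k)]
  have h5 := mul_le_mul_of_nonneg_left (h3.trans (add_le_add_left h4 _))
    (by linarith : 0 ≤ B + 1)
  have h6 := mul_le_mul_of_nonneg_left h1 hB
  have e : 240 * √k * Real.log N * (B + 1) / √N = (B + 1) * (240 * √k * Real.log N / √N) := by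
    ring
  rw [e]
  nlinarith [mul_nonneg hB hs0]

theorem mainTheorem6 {L : ℕ} (hL : 1 ≤ L) (w : Fin (L + 1) → ℕ)
    (σ : Fin L → ℝ → ℝ) (ρ : Fin L → ℝ≥0)
    (hσ : ∀ ℓ, LipschitzWith (ρ ℓ) (σ ℓ)) (hσ0 : ∀ ℓ, σ ℓ 0 = 0)
    {Y : Type*} [MeasurableSpace Y]
    (l : (Fin (w (Fin.last L)) → ℝ) → Y → ℝ) (B : ℝ) (lip : ℝ≥0)
    (hl_meas : ∀ u, Measurable (l u))
    (hl_bound : ∀ u y, 0 ≤ l u y ∧ l u y ≤ B)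
    (hl_lip : ∀ y, LipschitzWith lip (fun u => l u y))
    (D : Measure (EuclideanSpace ℝ (Fin (w 0)) × Y)) [IsProbabilityMeasure D]
    {N : ℕ} (hN : 1 ≤ N) {δ : ℝ} (hδ : 0 < δ) :
    ∃ E : Set (Fin N → EuclideanSpace ℝ (Fin (w 0)) × Y),
      MeasurableSet E ∧
      1 - δ ≤ (Measure.pi (fun _ : Fin N => D)).real E ∧
      ∀ S ∈ E, ∀ A : Weights w,
        generalizationGap D l S (network σ A) ≤
          6 * (B + 1) * √(Real.log (4 / δ) / N)
          + 240 * √(Real.logb 2 (4 * gammaR N lip ρ (sampleRadius S) A)) * Real.log N * (B + 1)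
              / √N * √(rankComplexity A)
          + √((Real.log (4 / δ)
                + 2 * Real.log ((sampleRadius S + 2) * ∏ ℓ, (matrixSpectralNorm (A ℓ) + 2))
                + L * Real.log (maxWidth w)) / N) := by
  rcases le_or_gt 1 δ with hδ1 | hδ1
  · exact ⟨∅, MeasurableSet.empty, by simpa using hδ1, fun S hS => absurd hS (Set.notMem_empty S)⟩
  have hNR : (1 : ℝ) ≤ N := by exact_mod_cast hN
  have hB : 0 ≤ B := by
    obtain ⟨z⟩ : Nonempty (EuclideanSpace ℝ (Fin (w 0)) × Y) := nonempty_of_isProbabilityMeasure D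
    exact (hl_bound 0 z.2).1.trans (hl_bound 0 z.2).2
  set u := Real.log (4 / δ) with hu
  have hexpu : Real.exp (-u) = δ / 4 := by
    rw [Real.exp_neg, hu, Real.exp_log (by positivity), inv_div]
  have hu1 : 1 < u := by
    rw [hu, Real.lt_log_iff_exp_lt (by positivity)]
    have h4 : (4 : ℝ) < 4 / δ := by rw [lt_div_iff₀ hδ]; linarith
    linarith [Real.exp_one_lt_d9]
  have hmeas : ∀ A : Weights w, Measurable fun z : EuclideanSpace ℝ (Fin (w 0)) × Y =>
      l (network σ A z.1) z.2 := by
    intro A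
    have h : Measurable (Function.uncurry l) :=
      measurable_uncurry_of_continuous_of_measurable (fun y => (hl_lip y).continuous) hl_meas
    exact h.comp (((continuous_network hσ A).measurable.comp measurable_fst).prodMk measurable_snd)
  -- The last summand of the bound is not needed.
  suffices hmain : ∃ E : Set (Fin N → EuclideanSpace ℝ (Fin (w 0)) × Y), MeasurableSet E ∧
      1 - δ ≤ (Measure.pi (fun _ : Fin N => D)).real E ∧ ∀ S ∈ E, ∀ A : Weights w,
        generalizationGap D l S (network σ A) ≤ 6 * (B + 1) * √(u / N)
          + 240 * √(rankComplexity A * Real.logb 2 (4 * gammaR N lip ρ (sampleRadius S) A))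
            * Real.log N * (B + 1) / √N by
    obtain ⟨E, hE, hE', h⟩ := hmain
    refine ⟨E, hE, hE', fun S hS A => (h S hS A).trans ?_⟩
    rw [Real.sqrt_mul (rankComplexity_nonneg A)]
    refine le_trans (le_of_eq ?_) (le_add_of_nonneg_right (Real.sqrt_nonneg _))
    ring
  have hlogN : 0 ≤ Real.log N := Real.log_nonneg hNR
  rcases le_or_gt (N : ℝ) u with huN | huN
  · -- The claimed bound is at least `B`, which dominates the deviation.
    refine ⟨Set.univ, MeasurableSet.univ, by simpa using hδ.le, fun S _ A => ?_⟩
    have hgap : generalizationGap D l S (network σ A) ≤ B := by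
      have h1 : ∫ z, l (network σ A z.1) z.2 ∂D ≤ B := by
        refine (integral_mono (.of_mem_Icc 0 B (hmeas A).aemeasurable
          (.of_forall fun z => hl_bound _ _)) (integrable_const B)
          fun z => (hl_bound _ _).2).trans_eq (by simp)
      have h2 : 0 ≤ (1 / (N : ℝ)) * ∑ i, l (network σ A (S i).1) (S i).2 :=
        mul_nonneg (by positivity) (Finset.sum_nonneg fun i _ => (hl_bound _ _).1)
      unfold generalizationGap
      linarith
    have hs : 1 ≤ √(u / N) := Real.one_le_sqrt.2 ((one_le_div (by linarith)).2 huN)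
    have h0 : 0 ≤ 240 * √(rankComplexity A *
        Real.logb 2 (4 * gammaR N lip ρ (sampleRadius S) A)) * Real.log N * (B + 1) / √N := by
      positivity
    nlinarith
  have hN2 : (2 : ℝ) ≤ N := by
    have : 1 < N := by exact_mod_cast hu1.trans huN
    exact_mod_cast this
  obtain ⟨R, hR1, hR2⟩ := exists_radius D N (div_pos (by linarith) (by linarith) : 0 < u / N)
    ((div_lt_one (by linarith)).2 huN)
  rw [div_mul_cancel₀ _ (by linarith), hexpu] at hR2
  set f : GridIndex w → EuclideanSpace ℝ (Fin (w 0)) × Y → ℝ := fun i =>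
    {z : EuclideanSpace ℝ (Fin (w 0)) × Y | ‖z.1‖ ≤ R}.indicator
      fun z => l (network σ (gridWeights i.2) z.1) z.2 with hf
  have hball : MeasurableSet {z : EuclideanSpace ℝ (Fin (w 0)) × Y | ‖z.1‖ ≤ R} :=
    measurableSet_le (by fun_prop) measurable_const
  -- The range is enlarged to `B + 1`, which is positive even when `B = 0`.
  have hunion := measure_exists_deviation_le D hN (f := f) (C := B + 1)
    (fun i => (hmeas _).indicator hball) (by linarith)
    (fun i z => ⟨Set.indicator_nonneg (fun z _ => (hl_bound _ _).1) z,
      Set.indicator_apply_le' (fun _ => by linarith [(hl_bound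
        (network σ (gridWeights i.2) z.1) z.2).2]) (fun _ => by linarith)⟩)
    gridCost_nonneg tsum_exp_neg_gridCost_le (by linarith : 0 ≤ u)
  have hzero := measure_deviation_le D hN
    (f := fun z : EuclideanSpace ℝ (Fin (w 0)) × Y => l 0 z.2) ((hl_meas 0).comp measurable_snd)
    (by linarith : 0 < B + 1)
    (fun z => ⟨(hl_bound 0 z.2).1, by linarith [(hl_bound 0 z.2).2]⟩) (by linarith : 0 ≤ u)
  rw [hexpu] at hunion hzero
  set μ := Measure.pi (fun _ : Fin N => D)
  set bad1 : Set (Fin N → EuclideanSpace ℝ (Fin (w 0)) × Y) := {S | ∀ i, ‖(S i).1‖ < R}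
  set bad2 : Set (Fin N → EuclideanSpace ℝ (Fin (w 0)) × Y) := {S | ∃ i : GridIndex w,
    (B + 1) * √((gridCost i + u) / (2 * N)) <
      ∫ z, f i z ∂D - (1 / (N : ℝ)) * ∑ j, f i (S j)}
  set bad3 : Set (Fin N → EuclideanSpace ℝ (Fin (w 0)) × Y) :=
    {S | (B + 1) * √(u / (2 * N)) < ∫ z, l 0 z.2 ∂D - (1 / (N : ℝ)) * ∑ j, l 0 (S j).2}
  have hbad : μ (bad1 ∪ bad2 ∪ bad3) ≤ ENNReal.ofReal δ := by
    calc μ (bad1 ∪ bad2 ∪ bad3) ≤ μ bad1 + μ bad2 + μ bad3 :=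
          (measure_union_le _ _).trans (add_le_add_left (measure_union_le _ _) _)
      _ ≤ ENNReal.ofReal (δ / 4) + ENNReal.ofReal (δ / 4) + ENNReal.ofReal (δ / 4) := by gcongr
      _ = ENNReal.ofReal (δ / 4 + δ / 4 + δ / 4) := by
          rw [ENNReal.ofReal_add (by positivity) (by positivity),
            ENNReal.ofReal_add (by positivity) (by positivity)]
      _ ≤ ENNReal.ofReal δ := ENNReal.ofReal_le_ofReal (by linarith)
  -- Removing the measurable hull avoids checking that the bad event is measurable.
  refine ⟨(toMeasurable μ (bad1 ∪ bad2 ∪ bad3))ᶜ, (measurableSet_toMeasurable _ _).compl, ?_, ?_⟩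
  · rw [probReal_compl_eq_one_sub (measurableSet_toMeasurable _ _)]
    have : μ.real (toMeasurable μ (bad1 ∪ bad2 ∪ bad3)) ≤ δ := by
      rw [measureReal_def, measure_toMeasurable]
      exact ENNReal.toReal_le_of_le_ofReal hδ.le hbad
    linarith
  intro S hS A
  have hS' : S ∉ bad1 ∪ bad2 ∪ bad3 := fun h => hS (subset_toMeasurable _ _ h)
  simp only [Set.mem_union, not_or] at hS'
  obtain ⟨⟨hS1, hS2⟩, hS3⟩ := hS'
  have hsample : ∀ i, ‖(S i).1‖ ≤ sampleRadius S := fun i =>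
    le_ciSup (f := fun i => ‖(S i).1‖) (Set.finite_range _).bddAbove i
  have hradius : R ≤ sampleRadius S := by
    simp only [bad1, Set.mem_ofPred_eq, not_forall, not_lt] at hS1
    obtain ⟨i, hi⟩ := hS1
    exact hi.trans (hsample i)
  by_cases hA : ∀ ℓ, A ℓ ≠ 0
  · obtain ⟨i, hi, hclose⟩ := exists_gridIndex_close hL hσ hσ0 (lip := lip) hN hA
      ((norm_nonneg _).trans (hsample ⟨0, hN⟩))
    simp only [bad2, Set.mem_ofPred_eq, not_exists, not_lt] at hS2
    have hdev := deviation_le_of_close D hN (hmeas (gridWeights i.2)) (hmeas A)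
      (fun z => hl_bound _ _) (fun z => hl_bound _ _) (by positivity : (0 : ℝ) ≤ 1 / N) hradius
      (fun z hz => ?_) hsample
    · have hout := mul_le_mul_of_nonneg_left hR1 hB
      have hk : 0 ≤ rankComplexity A * Real.logb 2 (4 * gammaR N lip ρ (sampleRadius S) A) := by
        linarith [gridCost_nonneg i]
      refine le_trans ?_ (rate_le hB hu1.le huN.le hN2 hk hi)
      exact hdev.trans (add_le_add (hS2 i) (by linarith))
    · have h := (hl_lip z.2).dist_le_mul (network σ A z.1) (network σ (gridWeights i.2) z.1)
      rw [Real.dist_eq, dist_eq_norm] at h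
      exact h.trans (hclose z.1 hz)
  · push Not at hA
    obtain ⟨ℓ, hℓ⟩ := hA
    have hgap : generalizationGap D l S (network σ A) ≤ (B + 1) * √(u / (2 * N)) := by
      unfold generalizationGap
      simp only [network_eq_zero_of_weight_eq_zero hσ0 hℓ]
      exact not_lt.1 hS3
    have hs : √(u / (2 * N)) ≤ √(u / N) := by
      refine Real.sqrt_le_sqrt ?_
      gcongr
      linarith
    have h0 : 0 ≤ 240 * √(rankComplexity A *
        Real.logb 2 (4 * gammaR N lip ρ (sampleRadius S) A)) * Real.log N * (B + 1) / √N := by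
      positivity
    nlinarith [Real.sqrt_nonneg (u / N)]
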